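/- Let $G$ be a simple undirected graph with vertex set $[n]$, $n\ge 6$, that is regular, and let $\sigma_W,\sigma_B>0$. Let $\mathbf W=(W_i)_{i\in[n]}$ be i.i.d. $\mathcal N(0,\sigma_W^2)$ random variables, and let $\mathbf B=(B_{ij})_{(i,j)\in E(G)}$ be random variables, on the same probability space, with $B_{ij}=B_{ji}\sim\mathcal N(0,\sigma_B^2)$ for every edge $(i,j)$ of $G$ (a $(\sigma_W,\sigma_B)$-disordered energy landscape on $G$). Suppose that the landscape is separable: there are a measurable $f:\mathbb R\to\mathbb R$ and $\sigma>0$ such that, for every $i\in[n]$, the random variables $B_{ij}-f(W_i)$, $j\sim i$, are i.i.d. $\mathcal N(0,\sigma^2)$ and the vector $(B_{ij}-f(W_i))_{j\sim i}$ is independent of $W_i$. Put $$A_i=\log\sum_{j:\,j\sim i}e^{-B_{ij}},\qquad r=\sqrt{\frac{\operatorname{Var}A_I}{\operatorname{Var}W_I}},$$ where $\operatorname{Var}$ denotes the variance over a uniformly random $I\in[n]$ independent of $(\mathbf W,\mathbf B)$, with $(\mathbf W,\mathbf B)$ held fixed (if $G$ has no edges, set $\log 0=0$). Then $r^2$ is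 integrable and $$\mathbb E(r^2)=\mathbb E\left(\frac{\operatorname{Var}A_I}{\operatorname{Var}W_I}\right)\le 4\left(1+O(n^{-1/2})\right)\left(\frac{\sigma_B}{\sigma_W}\right)^2,$$ that is, there is a universal constant $C$, independent of $n$, $G$, $\sigma_W$, $\sigma_B$ and the landscape, such that $\mathbb E(r^2)\le 4\,(1+C\,n^{-1/2})\,(\sigma_B/\sigma_W)^2$ for all $n\ge6$. -/

import Mathlib

open MeasureTheory ProbabilityTheory

namespace Landscape

/-- `(W, B)` is a `(σW, σB)`-disordered energy landscape on the graph `G`: the well depths `W i` are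
i.i.d. `N(0, σW²)`, and the barrier heights, indexed by ordered pairs of adjacent vertices, are
symmetric and have law `N(0, σB²)`. The values of `B` at non-adjacent pairs are irrelevant. -/
structure IsDisordered {Ω : Type*} [MeasurableSpace Ω] (P : Measure Ω) {n : ℕ}
    (G : SimpleGraph (Fin n)) (σW σB : ℝ) (W : Fin n → Ω → ℝ) (B : Fin n → Fin n → Ω → ℝ) :
    Prop where
  indep_wells : iIndepFun W P
  law_wells : ∀ i, HasLaw (W i) (gaussianReal 0 (σW ^ 2).toNNReal) P
  symm_barriers : ∀ i j, G.Adj i j → B i j = B j i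
  law_barriers : ∀ i j, G.Adj i j → HasLaw (B i j) (gaussianReal 0 (σB ^ 2).toNNReal) P

/-- The landscape `(W, B)` on `G` is separable: for some measurable `f` and some `σ > 0`, and for
every vertex `i`, the variables `B i j - f (W i)`, where `j` ranges over the neighbors of `i`, are
i.i.d. `N(0, σ²)`, and the vector that they form is independent of `W i`. -/
def IsSeparable {Ω : Type*} [MeasurableSpace Ω] (P : Measure Ω) {n : ℕ}
    (G : SimpleGraph (Fin n)) (W : Fin n → Ω → ℝ) (B : Fin n → Fin n → Ω → ℝ) : Prop :=
  ∃ f : ℝ → ℝ, Measurable f ∧ ∃ σ : ℝ, 0 < σ ∧ ∀ i : Fin n,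
    iIndepFun (fun (j : G.neighborSet i) (ω : Ω) => B i j ω - f (W i ω)) P ∧
    (∀ j : G.neighborSet i,
      HasLaw (fun ω => B i j ω - f (W i ω)) (gaussianReal 0 (σ ^ 2).toNNReal) P) ∧
    IndepFun (fun (ω : Ω) (j : G.neighborSet i) => B i j ω - f (W i ω)) (W i) P

/-- `A i = log ∑_{j ∼ i} exp (-B i j)`, for fixed barrier heights `b`. -/
noncomputable def logBarrierSum {n : ℕ} (G : SimpleGraph (Fin n)) [DecidableRel G.Adj]
    (b : Fin n → Fin n → ℝ) (i : Fin n) : ℝ :=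
  Real.log (∑ j ∈ G.neighborFinset i, Real.exp (-b i j))

/-- `Var x_I` for a fixed vector `x` and a uniformly random index `I`. -/
noncomputable def uniformVar {n : ℕ} (x : Fin n → ℝ) : ℝ :=
  Var[x; uniformOn (Set.univ : Set (Fin n))]

/-- The ratio `r = √(Var A_I / Var W_I)` for fixed well depths `w` and barrier heights `b`. -/
noncomputable def ratio {n : ℕ} (G : SimpleGraph (Fin n)) [DecidableRel G.Adj]
    (w : Fin n → ℝ) (b : Fin n → Fin n → ℝ) : ℝ :=
  √(uniformVar (logBarrierSum G b) / uniformVar w)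

end Landscape

/-! By AM–GM, `Var A_I / Var W_I` is at most a weighted sum of `(Var A_I)²` and `(Var W_I)⁻²`, so
two separate moment bounds suffice and the dependence between wells and barriers plays no role.

Numerator. Separability writes the barriers around `i` as `f (W i)` plus independent Gaussian noise.
Dividing characteristic functions shows that `f (W i)` is itself Gaussian, so these barriers form a
Gaussian vector, with the same law at every vertex of a regular graph (`exists_law_barriers`). `A i`
is then a log-sum-exp of this vector, whose gradient is minus a probability vector. The
Maurey–Pisier rotation argument therefore bounds its fourth central moment using only the fourth
moments of the coordinates, whatever the degree and the correlations
(`lintegral_logSumExpNeg_sub_mean_pow_four_le`). Centring all `A i` at the common mean gives `E (Var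
A_I)² ≤ 10 σB⁴`.

Denominator. `n Var W_I` is `σW²` times a chi-square variable with `n - 1` degrees of freedom.
Integrating its Laplace transform against `t dt` gives its inverse second moment, finite exactly
when `n > 5` (`lintegral_inv_sumSqDev_sq_le`).

Working with `lintegral` throughout makes integrability of `r²` a by-product. -/

namespace Landscape

/-! ### Log-sum-exp and its Gibbs weights. -/

section LogSumExp

variable {ι : Type*} [Fintype ι]

/-- The function `x ↦ log ∑ⱼ exp (-xⱼ)`. -/
noncomputable def logSumExpNeg (x : ι → ℝ) : ℝ := Real.log (∑ j, Real.exp (-x j))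

/-- The Gibbs weights, which are minus the partial derivatives of `logSumExpNeg`. -/
noncomputable def gibbsWeight (x : ι → ℝ) (j : ι) : ℝ :=
  Real.exp (-x j) / ∑ k, Real.exp (-x k)

lemma gibbsWeight_nonneg (x : ι → ℝ) (j : ι) : 0 ≤ gibbsWeight x j := by
  unfold gibbsWeight; positivity

lemma measurable_logSumExpNeg : Measurable (logSumExpNeg : (ι → ℝ) → ℝ) := by
  unfold logSumExpNeg; fun_prop

lemma measurable_gibbsWeight (j : ι) : Measurable (fun x : ι → ℝ => gibbsWeight x j) := by
  unfold gibbsWeight; fun_prop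

variable [Nonempty ι]

lemma sum_exp_neg_pos (x : ι → ℝ) : 0 < ∑ j, Real.exp (-x j) :=
  Finset.sum_pos (fun _ _ => Real.exp_pos _) Finset.univ_nonempty

lemma sum_gibbsWeight (x : ι → ℝ) : ∑ j, gibbsWeight x j = 1 := by
  unfold gibbsWeight
  rw [← Finset.sum_div, div_self (sum_exp_neg_pos x).ne']

lemma abs_logSumExpNeg_sub_log_card_le (x : ι → ℝ) :
    |logSumExpNeg x - Real.log (Fintype.card ι)| ≤ ‖x‖ := by
  have hc : (0 : ℝ) < Fintype.card ι := by exact_mod_cast Fintype.card_pos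
  have hx : ∀ j, |x j| ≤ ‖x‖ := fun j => by simpa using norm_le_pi_norm x j
  have hlog : ∀ t : ℝ, Real.log (Fintype.card ι * Real.exp t) = Real.log (Fintype.card ι) + t := by
    intro t
    rw [Real.log_mul hc.ne' (Real.exp_pos t).ne', Real.log_exp]
  have hs : ∀ t : ℝ, (Fintype.card ι : ℝ) * Real.exp t = ∑ _j : ι, Real.exp t := by
    intro t; simp
  rw [abs_le]
  constructor
  · have : Real.log (Fintype.card ι * Real.exp (-‖x‖)) ≤ logSumExpNeg x := by
      apply Real.log_le_log (by positivity)
      rw [hs]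
      gcongr with j
      exact (le_abs_self _).trans (hx j)
    rw [hlog] at this
    linarith
  · have : logSumExpNeg x ≤ Real.log (Fintype.card ι * Real.exp ‖x‖) := by
      apply Real.log_le_log (sum_exp_neg_pos x)
      rw [hs]
      gcongr with j
      exact (neg_le_abs _).trans (hx j)
    rw [hlog] at this
    linarith

lemma hasDerivAt_logSumExpNeg {u u' : ℝ → ι → ℝ} {t : ℝ}
    (hu : ∀ j, HasDerivAt (fun s => u s j) (u' t j) t) :
    HasDerivAt (fun s => logSumExpNeg (u s)) (-∑ j, gibbsWeight (u t) j * u' t j) t := by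
  have h1 : HasDerivAt (fun s => ∑ j, Real.exp (-u s j))
      (∑ j, Real.exp (-u t j) * (-u' t j)) t := by
    apply HasDerivAt.fun_sum
    intro j _
    exact (hu j).neg.exp
  refine (h1.log (sum_exp_neg_pos (u t)).ne').congr_deriv ?_
  rw [Finset.sum_div, ← Finset.sum_neg_distrib]
  refine Finset.sum_congr rfl fun j _ => ?_
  unfold gibbsWeight
  ring

/-- Jensen for the probability vector of Gibbs weights. This is what makes the final bound free of
the dimension. -/
lemma sum_gibbsWeight_mul_pow_four_le (x y : ι → ℝ) :
    (∑ j, gibbsWeight x j * y j) ^ 4 ≤ ∑ j, gibbsWeight x j * y j ^ 4 := by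
  have h := (Even.convexOn_pow (𝕜 := ℝ) (n := 4) (by decide)).map_sum_le (t := Finset.univ)
    (w := gibbsWeight x) (p := y) (fun j _ => gibbsWeight_nonneg x j) (sum_gibbsWeight x)
    (fun _ _ => Set.mem_univ _)
  simpa using h

end LogSumExp

/-! ### Fourth central moment of log-sum-exp by Gaussian rotation. -/

lemma pow_four_intervalIntegral_le {g : ℝ → ℝ} {T : ℝ} (hT : 0 < T) (hg : Continuous g) :
    (∫ t in (0 : ℝ)..T, g t) ^ 4 ≤ T ^ 3 * ∫ t in (0 : ℝ)..T, g t ^ 4 := by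
  set m := (∫ t in (0 : ℝ)..T, g t) / T with hm
  have hI : ∫ t in (0 : ℝ)..T, g t = T * m := by rw [hm]; field_simp
  have h1 : ∫ t in (0 : ℝ)..T, (m ^ 4 + 4 * m ^ 3 * (g t - m)) ≤ ∫ t in (0 : ℝ)..T, g t ^ 4 := by
    apply intervalIntegral.integral_mono_on hT.le
    · exact Continuous.intervalIntegrable (by fun_prop) _ _
    · exact Continuous.intervalIntegrable (by fun_prop) _ _
    · intro t _
      -- Tangent line of `x ^ 4` at the mean `m`: the gap is `(g - m)² ((g + m)² + 2 m²)`.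
      nlinarith [mul_nonneg (sq_nonneg (g t - m))
        (add_nonneg (sq_nonneg (g t + m)) (mul_nonneg zero_le_two (sq_nonneg m)))]
  have h2 : ∫ t in (0 : ℝ)..T, (m ^ 4 + 4 * m ^ 3 * (g t - m)) = T * m ^ 4 := by
    rw [intervalIntegral.integral_add, intervalIntegral.integral_const_mul,
      intervalIntegral.integral_sub, hI]
    · simp
    all_goals exact Continuous.intervalIntegrable (by fun_prop) _ _
  rw [h2] at h1
  rw [hI, mul_pow]
  calc T ^ 4 * m ^ 4 = T ^ 3 * (T * m ^ 4) := by ring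
    _ ≤ _ := by gcongr

section MaureyPisier

variable {ι : Type*} [Fintype ι] [Nonempty ι]

lemma continuous_gibbsWeight (j : ι) : Continuous (fun x : ι → ℝ => gibbsWeight x j) := by
  unfold gibbsWeight
  exact Continuous.div (by fun_prop) (by fun_prop) fun x => (sum_exp_neg_pos x).ne'

/-- The rotation path joins `z.1` (at `θ = 0`) to `z.2` (at `θ = π / 2`), and its velocity is the
second component of the rotated pair. Integrate the derivative along it and apply Jensen twice, in
`θ` and in the Gibbs weights. -/
lemma sub_logSumExpNeg_pow_four_le (z : (ι → ℝ) × (ι → ℝ)) :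
    (logSumExpNeg z.1 - logSumExpNeg z.2) ^ 4 ≤ (Real.pi / 2) ^ 3 *
      ∫ θ in (0 : ℝ)..(Real.pi / 2), ∑ j, gibbsWeight (ContinuousLinearMap.rotation θ z).1 j *
        (ContinuousLinearMap.rotation θ z).2 j ^ 4 := by
  have hc1 : ∀ j, Continuous fun θ : ℝ =>
      gibbsWeight (ContinuousLinearMap.rotation θ z).1 j := by
    intro j
    refine (continuous_gibbsWeight j).comp ?_
    simp only [ContinuousLinearMap.rotation_apply]
    fun_prop
  have hc2 : ∀ j, Continuous fun θ : ℝ => (ContinuousLinearMap.rotation θ z).2 j := by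
    intro j
    simp only [ContinuousLinearMap.rotation_apply]
    fun_prop
  have hderiv : ∀ θ : ℝ, HasDerivAt
      (fun s : ℝ => logSumExpNeg (ContinuousLinearMap.rotation s z).1)
      (-∑ j, gibbsWeight (ContinuousLinearMap.rotation θ z).1 j *
        (ContinuousLinearMap.rotation θ z).2 j) θ := by
    intro θ
    apply hasDerivAt_logSumExpNeg (u' := fun θ => (ContinuousLinearMap.rotation θ z).2)
    intro j
    simp only [ContinuousLinearMap.rotation_apply, Pi.add_apply, Pi.smul_apply, smul_eq_mul]
    exact ((Real.hasDerivAt_cos θ).mul_const _).add ((Real.hasDerivAt_sin θ).mul_const _)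
  have hcont : Continuous fun θ : ℝ => -∑ j, gibbsWeight (ContinuousLinearMap.rotation θ z).1 j *
        (ContinuousLinearMap.rotation θ z).2 j := by fun_prop
  have hint := intervalIntegral.integral_eq_sub_of_hasDerivAt (a := 0) (b := Real.pi / 2)
    (fun θ _ => hderiv θ) (hcont.intervalIntegrable _ _)
  simp only [ContinuousLinearMap.rotation_apply, Real.cos_pi_div_two, Real.sin_pi_div_two,
    Real.cos_zero, Real.sin_zero, zero_smul, one_smul, zero_add, add_zero] at hint
  have h4 : (logSumExpNeg z.1 - logSumExpNeg z.2) ^ 4 =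
      (logSumExpNeg z.2 - logSumExpNeg z.1) ^ 4 := by ring
  rw [h4, ← hint]
  have hpi : 0 < Real.pi / 2 := by positivity
  refine (pow_four_intervalIntegral_le hpi ?_).trans ?_
  · simpa only [ContinuousLinearMap.rotation_apply] using hcont
  · gcongr
    apply intervalIntegral.integral_mono_on hpi.le
    · exact Continuous.intervalIntegrable
        (by fun_prop) _ _
    · exact Continuous.intervalIntegrable (by fun_prop) _ _
    · intro θ _
      rw [Even.neg_pow (by decide)]
      exact sum_gibbsWeight_mul_pow_four_le _ _

/-- At each angle the rotated pair is again a pair of independent copies, so position (in the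
weights) and velocity (in the fourth powers) decouple. Independence of the coordinates under `μ` is
not needed. -/
lemma lintegral_sub_logSumExpNeg_pow_four_le (μ : Measure (ι → ℝ)) [IsGaussian μ]
    (hμ : μ[id] = 0) {K : ℝ}
    (hμ4 : ∀ j, ∫⁻ x, ENNReal.ofReal (x j ^ 4) ∂μ ≤ ENNReal.ofReal K) :
    ∫⁻ z, ENNReal.ofReal ((logSumExpNeg z.1 - logSumExpNeg z.2) ^ 4) ∂(μ.prod μ) ≤
      ENNReal.ofReal ((Real.pi / 2) ^ 4 * K) := by
  set Φ : (ι → ℝ) × (ι → ℝ) → ENNReal := fun z =>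
    ∑ j, ENNReal.ofReal (gibbsWeight z.1 j) * ENNReal.ofReal (z.2 j ^ 4) with hΦ
  have hΦm : Measurable Φ := by
    refine Finset.measurable_sum _ fun j _ => ?_
    exact ((measurable_gibbsWeight j).comp measurable_fst).ennreal_ofReal.mul (by fun_prop)
  have hrot : Measurable fun p : ((ι → ℝ) × (ι → ℝ)) × ℝ =>
      ContinuousLinearMap.rotation p.2 p.1 := by
    simp only [ContinuousLinearMap.rotation_apply]
    fun_prop
  have hΦint : ∫⁻ z, Φ z ∂(μ.prod μ) ≤ ENNReal.ofReal K := by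
    rw [lintegral_prod _ hΦm.aemeasurable]
    calc ∫⁻ x, ∫⁻ y, Φ (x, y) ∂μ ∂μ ≤ ∫⁻ x, ENNReal.ofReal K ∂μ := by
          refine lintegral_mono fun x => ?_
          simp only [hΦ]
          rw [lintegral_finsetSum _ (fun j _ => by fun_prop)]
          calc ∑ j, ∫⁻ y, ENNReal.ofReal (gibbsWeight x j) * ENNReal.ofReal (y j ^ 4) ∂μ
              = ∑ j, ENNReal.ofReal (gibbsWeight x j) * ∫⁻ y, ENNReal.ofReal (y j ^ 4) ∂μ := by
                refine Finset.sum_congr rfl fun j _ => ?_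
                rw [lintegral_const_mul _ (by fun_prop)]
            _ ≤ ∑ j, ENNReal.ofReal (gibbsWeight x j) * ENNReal.ofReal K := by
                gcongr with j; exact hμ4 j
            _ = ENNReal.ofReal K := by
                rw [← Finset.sum_mul, ← ENNReal.ofReal_sum_of_nonneg
                  (fun j _ => gibbsWeight_nonneg x j), sum_gibbsWeight]
                simp
      _ = ENNReal.ofReal K := by simp
  have hpt : ∀ z : (ι → ℝ) × (ι → ℝ),
      ENNReal.ofReal ((logSumExpNeg z.1 - logSumExpNeg z.2) ^ 4) ≤
        ENNReal.ofReal ((Real.pi / 2) ^ 3) *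
          ∫⁻ θ in Set.Ioc 0 (Real.pi / 2), Φ (ContinuousLinearMap.rotation θ z) := by
    intro z
    refine (ENNReal.ofReal_le_ofReal (sub_logSumExpNeg_pow_four_le z)).trans ?_
    rw [ENNReal.ofReal_mul (by positivity)]
    gcongr
    have hcont : Continuous fun θ : ℝ => ∑ j, gibbsWeight (ContinuousLinearMap.rotation θ z).1 j *
        (ContinuousLinearMap.rotation θ z).2 j ^ 4 := by
      refine continuous_finsetSum _ fun j _ => ?_
      simp only [ContinuousLinearMap.rotation_apply]
      exact ((continuous_gibbsWeight j).comp (by fun_prop)).mul (by fun_prop)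
    have hpi : 0 ≤ Real.pi / 2 := by positivity
    rw [intervalIntegral.integral_of_le hpi, ofReal_integral_eq_lintegral_ofReal
      ((intervalIntegrable_iff_integrableOn_Ioc_of_le hpi).1 (hcont.intervalIntegrable _ _))
      (Filter.Eventually.of_forall fun θ => Finset.sum_nonneg fun j _ =>
        mul_nonneg (gibbsWeight_nonneg _ j) (Even.pow_nonneg (by decide) _))]
    refine le_of_eq (lintegral_congr fun θ => ?_)
    rw [ENNReal.ofReal_sum_of_nonneg fun j _ =>
        mul_nonneg (gibbsWeight_nonneg _ j) (Even.pow_nonneg (by decide) _)]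
    exact Finset.sum_congr rfl fun j _ => ENNReal.ofReal_mul (gibbsWeight_nonneg _ j)
  have hjoint : Measurable fun p : ((ι → ℝ) × (ι → ℝ)) × ℝ =>
      Φ (ContinuousLinearMap.rotation p.2 p.1) := hΦm.comp hrot
  calc ∫⁻ z, ENNReal.ofReal ((logSumExpNeg z.1 - logSumExpNeg z.2) ^ 4) ∂(μ.prod μ)
      ≤ ∫⁻ z, ENNReal.ofReal ((Real.pi / 2) ^ 3) *
          ∫⁻ θ in Set.Ioc 0 (Real.pi / 2), Φ (ContinuousLinearMap.rotation θ z) ∂volume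
            ∂(μ.prod μ) :=
        lintegral_mono hpt
    _ = ENNReal.ofReal ((Real.pi / 2) ^ 3) * ∫⁻ θ in Set.Ioc 0 (Real.pi / 2),
          ∫⁻ z, Φ (ContinuousLinearMap.rotation θ z) ∂(μ.prod μ) := by
        rw [lintegral_const_mul' _ _ ENNReal.ofReal_ne_top, lintegral_lintegral_swap]
        exact hjoint.aemeasurable
    _ ≤ ENNReal.ofReal ((Real.pi / 2) ^ 3) *
          ∫⁻ _θ in Set.Ioc 0 (Real.pi / 2), ENNReal.ofReal K := by
        refine mul_le_mul_right (lintegral_mono fun θ => ?_) _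
        rw [← lintegral_map hΦm (by fun_prop), IsGaussian.map_rotation_eq_self hμ θ]
        exact hΦint
    _ = ENNReal.ofReal ((Real.pi / 2) ^ 4 * K) := by
        rw [setLIntegral_const, Real.volume_Ioc, mul_comm (ENNReal.ofReal K), ← mul_assoc,
          ← ENNReal.ofReal_mul (by positivity), sub_zero, ← ENNReal.ofReal_mul (by positivity)]
        congr 1

lemma memLp_logSumExpNeg (μ : Measure (ι → ℝ)) [IsGaussian μ] {p : ENNReal} (hp : p ≠ ⊤) :
    MemLp logSumExpNeg p μ := by
  have h1 : MemLp (fun x : ι → ℝ => logSumExpNeg x - Real.log (Fintype.card ι)) p μ :=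
    (IsGaussian.memLp_id μ p hp).mono
      (measurable_logSumExpNeg.sub_const _).aestronglyMeasurable
      (Filter.Eventually.of_forall abs_logSumExpNeg_sub_log_card_le)
  refine (h1.add (memLp_const (Real.log (Fintype.card ι)))).congr_norm
    measurable_logSumExpNeg.aestronglyMeasurable (Filter.Eventually.of_forall fun x => ?_)
  simp

end MaureyPisier

/-- For a centred `Y` with independent copy `Y'`, the odd cross terms vanish and `E (Y - Y')⁴ = 2 E
Y⁴ + 6 (E Y²)²`. -/
lemma two_mul_integral_pow_four_le {E : Type*} [MeasurableSpace E] (μ : Measure E)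
    [IsProbabilityMeasure μ] {X : E → ℝ} (hX : MemLp X 4 μ) :
    2 * ∫ x, (X x - μ[X]) ^ 4 ∂μ ≤ ∫ z, (X z.1 - X z.2) ^ 4 ∂(μ.prod μ) := by
  set Y : E → ℝ := fun x => X x - μ[X] with hY
  have hYL : MemLp Y 4 μ := hX.sub (memLp_const _)
  have hpow : ∀ k : ℕ, k ≤ 4 → Integrable (fun x => Y x ^ k) μ := by
    intro k hk
    have : MemLp Y k μ := hYL.mono_exponent (by exact_mod_cast hk)
    rcases Nat.eq_zero_or_pos k with rfl | h0
    · simp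
    · exact (this.integrable_norm_pow h0.ne').mono
        (this.aestronglyMeasurable.pow k) (Filter.Eventually.of_forall fun x => by simp)
  have hY0 : ∫ x, Y x ∂μ = 0 := by
    rw [hY, integral_sub (hX.integrable (by norm_num)) (integrable_const _)]
    simp
  have hI : ∀ a b : ℕ, a ≤ 4 → b ≤ 4 →
      Integrable (fun z : E × E => Y z.1 ^ a * Y z.2 ^ b) (μ.prod μ) := fun a b ha hb =>
    (hpow a ha).mul_prod (hpow b hb)
  have hE : ∀ a b : ℕ, ∫ z : E × E, Y z.1 ^ a * Y z.2 ^ b ∂(μ.prod μ) =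
      (∫ x, Y x ^ a ∂μ) * ∫ x, Y x ^ b ∂μ := fun a b =>
    integral_prod_mul (fun x => Y x ^ a) (fun x => Y x ^ b)
  have hexp : ∀ z : E × E, (X z.1 - X z.2) ^ 4 =
      Y z.1 ^ 4 * Y z.2 ^ 0 + Y z.1 ^ 0 * Y z.2 ^ 4 + 6 * (Y z.1 ^ 2 * Y z.2 ^ 2)
        - 4 * (Y z.1 ^ 3 * Y z.2 ^ 1) - 4 * (Y z.1 ^ 1 * Y z.2 ^ 3) := by
    intro z
    simp only [hY]
    ring
  have h40 := hI 4 0 (by norm_num) (by norm_num)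
  have h04 := hI 0 4 (by norm_num) (by norm_num)
  have h22 := (hI 2 2 (by norm_num) (by norm_num)).const_mul 6
  have h31 := (hI 3 1 (by norm_num) (by norm_num)).const_mul 4
  have h13 := (hI 1 3 (by norm_num) (by norm_num)).const_mul 4
  have h1 := h40.add h04
  have h2 := h1.add h22
  have h3 := h2.sub h31
  simp_rw [hexp]
  rw [integral_sub (by exact h3) h13, integral_sub (by exact h2) h31,
    integral_add (by exact h1) h22, integral_add h40 h04]
  simp only [integral_const_mul, hE]
  simp only [pow_zero, pow_one, hY0, integral_const, probReal_univ, smul_eq_mul]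
  nlinarith [sq_nonneg (∫ x, Y x ^ 2 ∂μ)]

lemma lintegral_logSumExpNeg_sub_mean_pow_four_le {ι : Type*} [Fintype ι] [Nonempty ι]
    (μ : Measure (ι → ℝ)) [IsGaussian μ] (hμ : μ[id] = 0) {v : ℝ}
    (hμ4 : ∀ j, ∫⁻ x, ENNReal.ofReal (x j ^ 4) ∂μ ≤ ENNReal.ofReal (3 * v ^ 2)) :
    ∫⁻ x, ENNReal.ofReal ((logSumExpNeg x - μ[logSumExpNeg]) ^ 4) ∂μ ≤
      ENNReal.ofReal (10 * v ^ 2) := by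
  have hL := memLp_logSumExpNeg μ (p := 4) (by norm_num)
  have hM4 : MemLp (fun x => logSumExpNeg x - μ[logSumExpNeg]) 4 μ := hL.sub (memLp_const _)
  have hint : Integrable (fun x => (logSumExpNeg x - μ[logSumExpNeg]) ^ 4) μ := by
    have := hM4.integrable_norm_pow (p := 4) (by norm_num)
    simpa [Even.pow_abs (show Even 4 by decide)] using this
  have h4 : ∀ t : ℝ, 0 ≤ t ^ 4 := fun t => Even.pow_nonneg (by decide) t
  rw [← ofReal_integral_eq_lintegral_ofReal hint (Filter.Eventually.of_forall fun x => h4 _)]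
  apply ENNReal.ofReal_le_ofReal
  have h1 := two_mul_integral_pow_four_le μ hL
  have h2 := lintegral_sub_logSumExpNeg_pow_four_le μ hμ hμ4
  have h3 : ∫ z, (logSumExpNeg z.1 - logSumExpNeg z.2) ^ 4 ∂(μ.prod μ) ≤
      (Real.pi / 2) ^ 4 * (3 * v ^ 2) := by
    rw [integral_eq_lintegral_of_nonneg_ae (Filter.Eventually.of_forall fun z => h4 _)
      (by exact (((measurable_logSumExpNeg.comp measurable_fst).sub
        (measurable_logSumExpNeg.comp measurable_snd)).pow_const 4).aestronglyMeasurable)]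
    exact ENNReal.toReal_le_of_le_ofReal (by positivity) h2
  have hpi : (Real.pi / 2) ^ 4 ≤ (1.6 : ℝ) ^ 4 := by
    -- The constant 10 comes from `(3 / 2) (π / 2)⁴ ≤ (3 / 2) 1.6⁴ < 10`.
    gcongr
    linarith [Real.pi_lt_d2]
  nlinarith [sq_nonneg v]

/-! ### Explicit one-dimensional Gaussian integrals. -/

lemma integral_pow_four_gaussianReal (v : NNReal) :
    ∫ x, x ^ 4 ∂(gaussianReal 0 v) = 3 * (v : ℝ) ^ 2 := by
  have h := iteratedDeriv_mgf_zero (X := fun x : ℝ => x) (μ := gaussianReal 0 v) (by simp) 4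
  -- Every derivative of the moment generating function is a polynomial times the same exponential,
  -- so only the polynomial factor is tracked.
  have hd : ∀ p p' : ℝ → ℝ, (∀ t, HasDerivAt p (p' t) t) →
      deriv (fun t : ℝ => p t * Real.exp (v * t ^ 2 / 2)) =
        fun t => (p' t + v * t * p t) * Real.exp (v * t ^ 2 / 2) := by
    intro p p' hp
    ext t
    have h2 : HasDerivAt (fun t : ℝ => (v : ℝ) * t ^ 2 / 2) (v * t) t := by
      refine (((hasDerivAt_pow 2 t).const_mul (v : ℝ)).div_const 2).congr_deriv ?_
      simp; ring
    refine ((hp t).mul h2.exp).deriv.trans ?_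
    ring
  have e0 : mgf (fun x : ℝ => x) (gaussianReal 0 v) =
      fun t => 1 * Real.exp (v * t ^ 2 / 2) := by
    rw [mgf_fun_id_gaussianReal]; simp
  rw [e0, iteratedDeriv_succ', hd (fun _ => 1) (fun _ => 0) (fun t => hasDerivAt_const t _),
    iteratedDeriv_succ', hd _ (fun _ => v), iteratedDeriv_succ',
    hd _ (fun t => 2 * v ^ 2 * t), iteratedDeriv_one,
    hd _ (fun t => 3 * v ^ 2 + 3 * v ^ 3 * t ^ 2)] at h
  · simpa using h.symm
  · intro t
    have h1 : HasDerivAt (fun t : ℝ => 3 * (v : ℝ) ^ 2 * t + (v : ℝ) ^ 3 * t ^ 3)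
        (3 * v ^ 2 + 3 * v ^ 3 * t ^ 2) t := by
      refine (((hasDerivAt_id t).const_mul _).add ((hasDerivAt_pow 3 t).const_mul _)).congr_deriv ?_
      simp; ring
    refine h1.congr_of_eventuallyEq (Filter.Eventually.of_forall fun s => ?_)
    simp only
    ring
  · intro t
    have h1 : HasDerivAt (fun t : ℝ => (v : ℝ) + (v : ℝ) ^ 2 * t ^ 2) (2 * v ^ 2 * t) t := by
      refine (((hasDerivAt_pow 2 t).const_mul _).const_add _).congr_deriv ?_
      simp; ring
    refine h1.congr_of_eventuallyEq (Filter.Eventually.of_forall fun s => ?_)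
    simp only
    ring
  · intro t
    refine ((hasDerivAt_id t).const_mul (v : ℝ)).congr_deriv (by simp) |>.congr_of_eventuallyEq
      (Filter.Eventually.of_forall fun s => ?_)
    simp

lemma lintegral_pow_four_gaussianReal (v : NNReal) :
    ∫⁻ x, ENNReal.ofReal (x ^ 4) ∂(gaussianReal 0 v) = ENNReal.ofReal (3 * (v : ℝ) ^ 2) := by
  have hint : Integrable (fun x : ℝ => x ^ 4) (gaussianReal 0 v) := by
    have := (memLp_id_gaussianReal (μ := 0) (v := v) 4).integrable_norm_pow (p := 4) (by norm_num)
    simpa [Even.pow_abs (show Even 4 by decide)] using this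
  rw [← integral_pow_four_gaussianReal, ofReal_integral_eq_lintegral_ofReal hint
    (Filter.Eventually.of_forall fun x => Even.pow_nonneg (by decide) x)]

lemma lintegral_exp_quadratic_gaussianReal {v : NNReal} (hv : v ≠ 0) {s t : ℝ}
    (ht : 0 < 1 + 2 * t * v) :
    ∫⁻ x, ENNReal.ofReal (Real.exp (s * x - t * x ^ 2)) ∂(gaussianReal 0 v) =
      ENNReal.ofReal ((√(1 + 2 * t * v))⁻¹ * Real.exp (v * s ^ 2 / (2 * (1 + 2 * t * v)))) := by
  set D : ℝ := 1 + 2 * t * v with hD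
  have hv0 : (0 : ℝ) < v := by positivity
  set v' : NNReal := v / D.toNNReal with hv'
  have hv'c : (v' : ℝ) = v / D := by simp [hv', Real.coe_toNNReal _ ht.le]
  have hv'0 : v' ≠ 0 := by
    rw [← NNReal.coe_ne_zero, hv'c]; positivity
  -- Completing the square: the tilted density is a multiple of a Gaussian density of variance `v /
  -- D`.
  have hpt : ∀ x : ℝ, gaussianPDFReal 0 v x * Real.exp (s * x - t * x ^ 2) =
      ((√D)⁻¹ * Real.exp (v * s ^ 2 / (2 * D))) * gaussianPDFReal (s * v') v' x := by
    intro x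
    have h1 : √(2 * Real.pi * v) = √D * √(2 * Real.pi * v') := by
      rw [← Real.sqrt_mul ht.le, hv'c]
      congr 1
      field_simp
    have h2 : Real.exp (-(x - 0) ^ 2 / (2 * v)) * Real.exp (s * x - t * x ^ 2) =
        Real.exp (v * s ^ 2 / (2 * D)) * Real.exp (-(x - s * v') ^ 2 / (2 * v')) := by
      rw [← Real.exp_add, ← Real.exp_add, hv'c]
      congr 1
      field_simp
      rw [hD]
      ring
    simp only [gaussianPDFReal, h1, mul_inv]
    linear_combination ((√D)⁻¹ * (√(2 * Real.pi * v'))⁻¹) * h2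
  rw [gaussianReal_of_var_ne_zero _ hv,
    lintegral_withDensity_eq_lintegral_mul _ (measurable_gaussianPDF 0 v) (by fun_prop)]
  simp only [Pi.mul_apply, gaussianPDF]
  simp_rw [← ENNReal.ofReal_mul (gaussianPDFReal_nonneg _ _ _), hpt]
  simp_rw [ENNReal.ofReal_mul (show 0 ≤ (√D)⁻¹ * Real.exp (v * s ^ 2 / (2 * D)) by positivity)]
  rw [lintegral_const_mul _ (measurable_gaussianPDFReal _ _).ennreal_ofReal,
    lintegral_gaussianPDFReal_eq_one _ hv'0, mul_one]

/-! ### Inverse second moment of the sample variance. -/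

/-- The sum of squared deviations from the mean. -/
noncomputable def sumSqDev {n : ℕ} (w : Fin n → ℝ) : ℝ :=
  ∑ i, w i ^ 2 - (∑ i, w i) ^ 2 / n

lemma sumSqDev_nonneg {n : ℕ} (w : Fin n → ℝ) : 0 ≤ sumSqDev w := by
  have h := sq_sum_le_card_mul_sum_sq (s := Finset.univ) (f := w)
  rw [Finset.card_univ, Fintype.card_fin] at h
  unfold sumSqDev
  rw [sub_nonneg]
  apply div_le_of_le_mul₀ (by positivity) (by positivity)
  linarith

lemma measurable_sumSqDev {n : ℕ} : Measurable (sumSqDev : (Fin n → ℝ) → ℝ) := by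
  unfold sumSqDev; fun_prop

/-- The square of the sum couples the coordinates. Writing its exponential as a Gaussian average of
exponentials linear in the sum decouples them, with no orthogonal change of variables. -/
lemma lintegral_exp_neg_sumSqDev {n : ℕ} (hn : 0 < n) {v : NNReal} (hv : v ≠ 0) {t : ℝ}
    (ht : 0 < t) :
    ∫⁻ w, ENNReal.ofReal (Real.exp (-(t * sumSqDev w)))
        ∂(Measure.pi fun _ : Fin n => gaussianReal 0 v) =
      ENNReal.ofReal ((1 + 2 * t * v) ^ (-((n : ℝ) - 1) / 2)) := by
  have hv0 : (0 : ℝ) < v := by positivity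
  have hn0 : (0 : ℝ) < n := by exact_mod_cast hn
  set D : ℝ := 1 + 2 * t * v with hD
  have hD0 : 0 < D := by positivity
  -- Chosen so that `E exp (a g S) = exp (t S² / n)` for a standard normal `g`.
  set a : ℝ := √(2 * t / n) with ha
  have ha2 : a ^ 2 = 2 * t / n := Real.sq_sqrt (by positivity)
  have hlin : ∀ w : Fin n → ℝ, ENNReal.ofReal (Real.exp (-(t * sumSqDev w))) =
      ∫⁻ g, ∏ i, ENNReal.ofReal (Real.exp (a * g * w i - t * w i ^ 2)) ∂(gaussianReal 0 1) := by
    intro w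
    have h := lintegral_exp_quadratic_gaussianReal (v := 1) one_ne_zero (s := a * ∑ i, w i) (t := 0)
      (by simp)
    have hg : ∀ g : ℝ, ∏ i, ENNReal.ofReal (Real.exp (a * g * w i - t * w i ^ 2)) =
        ENNReal.ofReal (Real.exp (-(t * ∑ i, w i ^ 2))) *
          ENNReal.ofReal (Real.exp ((a * ∑ i, w i) * g - 0 * g ^ 2)) := by
      intro g
      rw [← ENNReal.ofReal_prod_of_nonneg (fun i _ => (Real.exp_pos _).le), ← Real.exp_sum,
        ← ENNReal.ofReal_mul (Real.exp_pos _).le, ← Real.exp_add, Finset.sum_sub_distrib,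
        ← Finset.mul_sum, ← Finset.mul_sum]
      ring_nf
    simp_rw [hg]
    rw [lintegral_const_mul _ (by fun_prop), h, ← ENNReal.ofReal_mul (Real.exp_pos _).le]
    congr 1
    simp only [mul_zero, add_zero, Real.sqrt_one, inv_one, one_mul, mul_one,
      NNReal.coe_one]
    rw [← Real.exp_add, mul_pow, ha2]
    congr 1
    unfold sumSqDev
    field_simp
    ring
  have hprod : ∀ g : ℝ, ∫⁻ w, ∏ i, ENNReal.ofReal (Real.exp (a * g * w i - t * w i ^ 2))
        ∂(Measure.pi fun _ : Fin n => gaussianReal 0 v) =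
      ENNReal.ofReal ((√D)⁻¹ ^ n) *
        ENNReal.ofReal (Real.exp (0 * g - (-(v * t / D)) * g ^ 2)) := by
    intro g
    have hind : iIndepFun (fun (i : Fin n) (w : Fin n → ℝ) =>
        ENNReal.ofReal (Real.exp (a * g * w i - t * w i ^ 2)))
        (Measure.pi fun _ : Fin n => gaussianReal 0 v) :=
      iIndepFun_pi (X := fun _ x => ENNReal.ofReal (Real.exp (a * g * x - t * x ^ 2)))
        (fun _ => by fun_prop)
    rw [lintegral_prod_eq_prod_lintegral_of_indepFun Finset.univ _ hind (fun i => by fun_prop)]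
    have h1 : ∀ i : Fin n, ∫⁻ w, ENNReal.ofReal (Real.exp (a * g * w i - t * w i ^ 2))
        ∂(Measure.pi fun _ : Fin n => gaussianReal 0 v) =
        ENNReal.ofReal ((√D)⁻¹ * Real.exp (v * (a * g) ^ 2 / (2 * D))) := by
      intro i
      rw [← lintegral_exp_quadratic_gaussianReal hv hD0]
      exact (measurePreserving_eval (fun _ : Fin n => gaussianReal 0 v) i).lintegral_comp
        (f := fun x => ENNReal.ofReal (Real.exp (a * g * x - t * x ^ 2))) (by fun_prop)
    simp_rw [h1]
    rw [Finset.prod_const, Finset.card_univ, Fintype.card_fin, ← ENNReal.ofReal_pow (by positivity),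
      mul_pow, ← ENNReal.ofReal_mul (by positivity), ← Real.exp_nat_mul, mul_pow, ha2]
    congr 3
    field_simp
    ring
  simp_rw [hlin]
  rw [lintegral_lintegral_swap (by fun_prop)]
  simp_rw [hprod]
  -- The remaining integral over `g` gives back a factor `√D`, turning `D ^ (-n / 2)` into `D ^ (-(n
  -- - 1) / 2)`.
  have h2 : 1 + 2 * (-(v * t / D)) * (1 : NNReal) = D⁻¹ := by
    rw [NNReal.coe_one]
    field_simp
    rw [hD]
    ring
  rw [lintegral_const_mul _ (by fun_prop), lintegral_exp_quadratic_gaussianReal one_ne_zero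
    (by rw [h2]; positivity), h2, ← ENNReal.ofReal_mul (by positivity)]
  congr 1
  simp only [Real.sqrt_inv, inv_inv, ne_eq, OfNat.ofNat_ne_zero, not_false_eq_true, zero_pow,
    mul_zero, zero_div, Real.exp_zero, mul_one]
  rw [Real.sqrt_eq_rpow, ← Real.rpow_neg hD0.le, ← Real.rpow_natCast, ← Real.rpow_mul hD0.le,
    ← Real.rpow_add hD0]
  congr 1
  ring

lemma lintegral_Ioi_mul_one_add_rpow_neg {v m : ℝ} (hv : 0 < v) (hm : 2 < m) :
    ∫⁻ t in Set.Ioi (0 : ℝ), ENNReal.ofReal (t * (1 + 2 * t * v) ^ (-m)) =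
      ENNReal.ofReal (1 / (4 * v ^ 2 * (m - 1) * (m - 2))) := by
  -- Antiderivative found by substituting `t = (D - 1) / (2 v)` with `D = 1 + 2 t v`.
  set F : ℝ → ℝ := fun t => 1 / (4 * v ^ 2) *
    ((1 + 2 * t * v) ^ (2 - m) / (2 - m) - (1 + 2 * t * v) ^ (1 - m) / (1 - m)) with hF
  have hderiv : ∀ t ∈ Set.Ici (0 : ℝ), HasDerivAt F (t * (1 + 2 * t * v) ^ (-m)) t := by
    intro t ht
    have ht0 : (0 : ℝ) ≤ t := ht
    have hD : 0 < 1 + 2 * t * v := by positivity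
    have hlin : HasDerivAt (fun t : ℝ => 1 + 2 * t * v) (2 * v) t := by
      refine ((((hasDerivAt_id t).const_mul 2).mul_const v).const_add 1).congr_deriv ?_
      ring
    have hp : ∀ p : ℝ, HasDerivAt (fun t : ℝ => (1 + 2 * t * v) ^ p)
        (2 * v * p * (1 + 2 * t * v) ^ (p - 1)) t := fun p =>
      hlin.rpow_const (Or.inl hD.ne')
    refine ((((hp (2 - m)).div_const (2 - m)).sub ((hp (1 - m)).div_const (1 - m))).const_mul
      (1 / (4 * v ^ 2))).congr_deriv ?_
    have e1 : (1 + 2 * t * v) ^ (2 - m - 1) = (1 + 2 * t * v) * (1 + 2 * t * v) ^ (-m) := by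
      rw [show (2 - m - 1) = 1 + -m by ring, Real.rpow_add hD, Real.rpow_one]
    have e2 : (1 + 2 * t * v) ^ (1 - m - 1) = (1 + 2 * t * v) ^ (-m) := by
      congr 1; ring
    rw [e1, e2]
    have h1 : 1 - m ≠ 0 := by linarith
    have h2 : 2 - m ≠ 0 := by linarith
    field_simp
    ring
  have hnn : ∀ t ∈ Set.Ioi (0 : ℝ), 0 ≤ t * (1 + 2 * t * v) ^ (-m) := by
    intro t ht
    have ht0 : (0 : ℝ) < t := ht
    positivity
  have hlim : Filter.Tendsto F Filter.atTop (nhds 0) := by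
    have hat : Filter.Tendsto (fun t : ℝ => 1 + 2 * t * v) Filter.atTop Filter.atTop := by
      apply Filter.tendsto_atTop_add_const_left
      exact (Filter.tendsto_id.const_mul_atTop two_pos).atTop_mul_const hv
    have hp : ∀ p : ℝ, p < 0 →
        Filter.Tendsto (fun t : ℝ => (1 + 2 * t * v) ^ p) Filter.atTop (nhds 0) := by
      intro p hp
      have := (tendsto_rpow_neg_atTop (neg_pos.2 hp)).comp hat
      simpa [Function.comp_def] using this
    have := (((hp (2 - m) (by linarith)).div_const (2 - m)).sub
      ((hp (1 - m) (by linarith)).div_const (1 - m))).const_mul (1 / (4 * v ^ 2))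
    simpa [hF] using this
  rw [← ofReal_integral_eq_lintegral_ofReal (integrableOn_Ioi_deriv_of_nonneg' hderiv hnn hlim)
    (ae_restrict_of_forall_mem measurableSet_Ioi hnn),
    integral_Ioi_of_hasDerivAt_of_nonneg' hderiv hnn hlim]
  congr 1
  have h1 : 1 - m ≠ 0 := by linarith
  have h2 : 2 - m ≠ 0 := by linarith
  have h3 : m - 1 ≠ 0 := by linarith
  have h4 : m - 2 ≠ 0 := by linarith
  simp only [hF, mul_zero, zero_mul, add_zero, Real.one_rpow]
  field_simp
  ring

/-- A Gamma integral, with equality for `S > 0`. At `S = 0` the left side is 0 by convention, so the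
inequality avoids any almost-sure positivity argument. -/
lemma ofReal_inv_sq_le_lintegral {S : ℝ} (hS : 0 ≤ S) :
    ENNReal.ofReal (S⁻¹ ^ 2) ≤
      ∫⁻ t in Set.Ioi (0 : ℝ), ENNReal.ofReal (t * Real.exp (-(t * S))) := by
  rcases hS.eq_or_lt with rfl | hS
  · simp
  have h := Real.integral_rpow_mul_exp_neg_mul_Ioi (a := 2) two_pos hS
  have hI : ∫ t in Set.Ioi (0 : ℝ), t * Real.exp (-(t * S)) = S⁻¹ ^ 2 := by
    rw [show S⁻¹ ^ 2 = (1 / S) ^ (2 : ℝ) * Real.Gamma 2 by simp, ← h]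
    refine setIntegral_congr_fun measurableSet_Ioi fun t _ => ?_
    rw [show (2 : ℝ) - 1 = 1 by norm_num, Real.rpow_one, mul_comm t S]
  have hint : IntegrableOn (fun t : ℝ => t * Real.exp (-(t * S))) (Set.Ioi 0) := by
    by_contra hc
    rw [integral_undef hc] at hI
    have : 0 < S⁻¹ ^ 2 := by positivity
    linarith
  rw [← hI, ofReal_integral_eq_lintegral_ofReal hint
    (ae_restrict_of_forall_mem measurableSet_Ioi fun t ht =>
      mul_nonneg (le_of_lt ht) (Real.exp_pos _).le)]

lemma lintegral_inv_sumSqDev_sq_le {n : ℕ} (hn : 6 ≤ n) {v : NNReal} (hv : v ≠ 0) :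
    ∫⁻ w, ENNReal.ofReal ((sumSqDev w)⁻¹ ^ 2)
        ∂(Measure.pi fun _ : Fin n => gaussianReal 0 v) ≤
      ENNReal.ofReal (1 / ((v : ℝ) ^ 2 * ((n - 3) * (n - 5)))) := by
  have hv0 : (0 : ℝ) < v := by positivity
  have hn6 : (6 : ℝ) ≤ n := by exact_mod_cast hn
  have hm := measurable_sumSqDev (n := n)
  calc ∫⁻ w, ENNReal.ofReal ((sumSqDev w)⁻¹ ^ 2)
        ∂(Measure.pi fun _ : Fin n => gaussianReal 0 v)
      ≤ ∫⁻ w, ∫⁻ t in Set.Ioi (0 : ℝ), ENNReal.ofReal (t * Real.exp (-(t * sumSqDev w)))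
          ∂volume ∂(Measure.pi fun _ : Fin n => gaussianReal 0 v) :=
        lintegral_mono fun w => ofReal_inv_sq_le_lintegral (sumSqDev_nonneg w)
    _ = ∫⁻ t in Set.Ioi (0 : ℝ), ∫⁻ w, ENNReal.ofReal (t * Real.exp (-(t * sumSqDev w)))
          ∂(Measure.pi fun _ : Fin n => gaussianReal 0 v) :=
        lintegral_lintegral_swap (by fun_prop)
    _ = ∫⁻ t in Set.Ioi (0 : ℝ), ENNReal.ofReal (t * (1 + 2 * t * v) ^ (-(((n : ℝ) - 1) / 2))) := by
        refine setLIntegral_congr_fun measurableSet_Ioi fun t ht => ?_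
        have ht0 : (0 : ℝ) < t := ht
        simp only [ENNReal.ofReal_mul ht0.le]
        rw [lintegral_const_mul _ (by fun_prop), lintegral_exp_neg_sumSqDev (by omega) hv ht0,
          neg_div]
    _ = ENNReal.ofReal (1 / ((v : ℝ) ^ 2 * ((n - 3) * (n - 5)))) := by
        rw [lintegral_Ioi_mul_one_add_rpow_neg hv0 (by linarith)]
        congr 2
        ring

/-! ### The Gaussian law of the barriers around a vertex. -/

section Law

lemma eq_gaussianReal_of_charFun_mul {ν : Measure ℝ} [IsProbabilityMeasure ν] {s u : NNReal}
    (h : ∀ t, charFun ν t * charFun (gaussianReal 0 s) t = charFun (gaussianReal 0 u) t) :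
    ν = gaussianReal 0 (u - s) := by
  have hch : ∀ t : ℝ, charFun ν t = Complex.exp (((s : ℝ) - u) * t ^ 2 / 2) := by
    intro t
    have := h t
    rw [charFun_gaussianReal, charFun_gaussianReal] at this
    rw [eq_div_of_mul_eq (Complex.exp_ne_zero _) this, ← Complex.exp_sub]
    congr 1
    push_cast
    ring
  -- A characteristic function is bounded by 1; this ensures that the `NNReal` subtraction `u - s`
  -- does not truncate.
  have hle : s ≤ u := by
    have h1 : ‖charFun ν 1‖ ≤ 1 := norm_charFun_le_one 1
    rw [hch 1, Complex.norm_exp, Real.exp_le_one_iff] at h1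
    have h2 : ((((s : ℝ) : ℂ) - ((u : ℝ) : ℂ)) * ((1 : ℝ) : ℂ) ^ 2 / 2).re = ((s : ℝ) - u) / 2 := by
      norm_cast
      ring
    rw [h2] at h1
    exact_mod_cast (by linarith : (s : ℝ) ≤ u)
  apply Measure.ext_of_charFun
  ext t
  rw [hch, charFun_gaussianReal, NNReal.coe_sub hle]
  congr 1
  push_cast
  ring

/-- The law of the vector `(g + xₖ)ₖ`, where `g` has law `ν` and the `xₖ` are independent of `g`
and i.i.d. `N(0, s)`. -/
noncomputable def shiftedGaussianLaw (ν : Measure ℝ) (s : NNReal) (d : ℕ) :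
    Measure (Fin d → ℝ) :=
  (ν.prod (Measure.pi fun _ : Fin d => gaussianReal 0 s)).map fun p k => p.1 + p.2 k

lemma isGaussian_shiftedGaussianLaw (ν : Measure ℝ) [IsGaussian ν] (s : NNReal) (d : ℕ) :
    IsGaussian (shiftedGaussianLaw ν s d) := by
  set L : ℝ × (Fin d → ℝ) →L[ℝ] (Fin d → ℝ) := ContinuousLinearMap.pi fun k =>
    ContinuousLinearMap.fst ℝ ℝ (Fin d → ℝ) +
      (ContinuousLinearMap.proj k).comp (ContinuousLinearMap.snd ℝ ℝ (Fin d → ℝ))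
  have : shiftedGaussianLaw ν s d =
    (ν.prod (Measure.pi fun _ : Fin d => gaussianReal 0 s)).map L := rfl
  have hpi : IsGaussian (Measure.pi fun _ : Fin d => gaussianReal 0 s) := by
    have h := (iIndepFun_pi (μ := fun _ : Fin d => gaussianReal 0 s) (X := fun _ x => x)
      (fun _ => by fun_prop)).hasGaussianLaw fun k => ⟨by
        rw [(measurePreserving_eval (fun _ : Fin d => gaussianReal 0 s) k).map_eq]
        infer_instance⟩
    simpa using h.isGaussian_map
  rw [this]
  infer_instance

variable {Ω : Type*} [MeasurableSpace Ω] {P : Measure Ω}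

lemma map_add_eq_shiftedGaussianLaw [IsProbabilityMeasure P] {ι : Type*} [Countable ι]
    {d : ℕ} (e : Fin d ≃ ι)
    {g : Ω → ℝ} {w : Ω → ℝ} {f : ℝ → ℝ} {ε : ι → Ω → ℝ} {s : NNReal} (hf : Measurable f)
    (hw : AEMeasurable w P) (hg : ∀ ω, g ω = f (w ω))
    (hind : iIndepFun ε P) (hε : ∀ j, HasLaw (ε j) (gaussianReal 0 s) P)
    (hεw : IndepFun (fun ω j => ε j ω) w P) :
    P.map (fun ω k => g ω + ε (e k) ω) = shiftedGaussianLaw ((P.map w).map f) s d := by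
  have hgf : g = f ∘ w := funext hg
  have hgm : AEMeasurable g P := by rw [hgf]; exact hf.comp_aemeasurable hw
  have hεm : ∀ j, AEMeasurable (ε j) P := fun j => (hε j).aemeasurable
  have hvm : AEMeasurable (fun ω k => ε (e k) ω) P := aemeasurable_pi_lambda _ fun k => hεm _
  have hpi : P.map (fun ω k => ε (e k) ω) = Measure.pi fun _ : Fin d => gaussianReal 0 s := by
    rw [(iIndepFun_iff_map_fun_eq_pi_map (fun k => hεm (e k))).1 (hind.precomp e.injective)]
    simp_rw [fun k => (hε (e k)).map_eq]
  have hindep : IndepFun g (fun ω k => ε (e k) ω) P := by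
    rw [hgf]
    exact (hεw.comp (φ := fun (x : ι → ℝ) (k : Fin d) => x (e k)) (ψ := f)
      (by fun_prop) hf).symm
  have hprod := (indepFun_iff_map_prod_eq_prod_map_map hgm hvm).1 hindep
  rw [hpi] at hprod
  unfold shiftedGaussianLaw
  rw [AEMeasurable.map_map_of_aemeasurable hf.aemeasurable hw, ← hgf, ← hprod,
    AEMeasurable.map_map_of_aemeasurable (Measurable.aemeasurable (by fun_prop))
      (hgm.prodMk hvm)]
  rfl

lemma exists_law_barriers [IsProbabilityMeasure P] {n : ℕ} [NeZero n] {G : SimpleGraph (Fin n)}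
    [DecidableRel G.Adj] {d : ℕ} (hG : G.IsRegularOfDegree d) (hd : 0 < d) {σW σB : ℝ}
    {W : Fin n → Ω → ℝ} {B : Fin n → Fin n → Ω → ℝ}
    (hD : IsDisordered P G σW σB W B) (hS : IsSeparable P G W B) :
    ∃ μ : Measure (Fin d → ℝ), IsGaussian μ ∧
      (∀ k, μ.map (fun x => x k) = gaussianReal 0 (σB ^ 2).toNNReal) ∧
      ∀ i, ∃ e : Fin d ≃ G.neighborSet i, HasLaw (fun ω k => B i (e k) ω) μ P := by
  obtain ⟨f, hf, σ, hσ, hsep⟩ := hS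
  set s : NNReal := (σ ^ 2).toNNReal
  set ν : Measure ℝ := (gaussianReal 0 (σW ^ 2).toNNReal).map f with hν
  have hνP : IsProbabilityMeasure ν := Measure.isProbabilityMeasure_map hf.aemeasurable
  have he : ∀ i, Nonempty (Fin d ≃ G.neighborSet i) := by
    intro i
    refine ⟨(Fintype.equivFinOfCardEq ?_).symm⟩
    rw [G.card_neighborSet_eq_degree, hG i]
  have hWm : ∀ i, AEMeasurable (W i) P := fun i => (hD.law_wells i).aemeasurable
  have hlaw : ∀ i (e : Fin d ≃ G.neighborSet i),
      HasLaw (fun ω k => B i (e k) ω) (shiftedGaussianLaw ν s d) P := by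
    intro i e
    obtain ⟨h1, h2, h3⟩ := hsep i
    refine ⟨aemeasurable_pi_lambda _ fun k => (hD.law_barriers i _ (e k).2).aemeasurable, ?_⟩
    have := map_add_eq_shiftedGaussianLaw e hf (hWm i) (fun _ => rfl) h1 h2 h3
    simpa [(hD.law_wells i).map_eq] using this
  have hmarg : ∀ k, (shiftedGaussianLaw ν s d).map (fun x => x k) =
      gaussianReal 0 (σB ^ 2).toNNReal := by
    intro k
    obtain ⟨e⟩ := he 0
    have hl := hlaw 0 e
    rw [← hl.map_eq, AEMeasurable.map_map_of_aemeasurable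
      (Measurable.aemeasurable (by fun_prop)) hl.aemeasurable]
    exact (hD.law_barriers 0 _ (e k).2).map_eq
  -- A barrier is `f (W 0)` plus independent Gaussian noise and is itself Gaussian, so `f (W 0)` is
  -- Gaussian. This needs a neighbor of vertex 0, hence `0 < d`.
  have hνG : IsGaussian ν := by
    obtain ⟨e⟩ := he 0
    set j := e ⟨0, hd⟩
    obtain ⟨-, h2, h3⟩ := hsep 0
    have hfW : AEMeasurable (fun ω => f (W 0 ω)) P := hf.comp_aemeasurable (hWm 0)
    have hind : IndepFun (fun ω => f (W 0 ω)) (fun ω => B 0 j ω - f (W 0 ω)) P :=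
      (h3.comp (φ := fun x : G.neighborSet 0 → ℝ => x j) (ψ := f) (by fun_prop) hf).symm
    have hch := hind.charFun_map_fun_add_eq_mul hfW (h2 j).aemeasurable
    simp only [add_sub_cancel] at hch
    have hmapf : P.map (fun ω => f (W 0 ω)) = ν := by
      rw [hν, ← (hD.law_wells 0).map_eq,
        AEMeasurable.map_map_of_aemeasurable hf.aemeasurable (hWm 0)]
      rfl
    rw [(h2 j).map_eq, hmapf] at hch
    have hB : P.map (fun ω => B 0 j ω) = gaussianReal 0 (σB ^ 2).toNNReal :=
      (hD.law_barriers 0 j j.2).map_eq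
    rw [hB] at hch
    rw [eq_gaussianReal_of_charFun_mul (ν := ν) fun t => (congrFun hch t).symm]
    infer_instance
  exact ⟨shiftedGaussianLaw ν s d, isGaussian_shiftedGaussianLaw ν s d, hmarg,
    fun i => ⟨(he i).some, hlaw i _⟩⟩

end Law

/-! ### Variance over a uniform index. -/

section UniformVar

variable {n : ℕ}

lemma integral_uniformOn_univ (x : Fin n → ℝ) :
    ∫ i, x i ∂(uniformOn (Set.univ : Set (Fin n))) = (∑ i, x i) / n := by
  rw [uniformOn, ProbabilityTheory.cond, Measure.restrict_univ, integral_smul_measure,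
    integral_count]
  simp [Measure.count_univ]
  ring

variable [NeZero n]

lemma uniformVar_eq (x : Fin n → ℝ) : uniformVar x = sumSqDev x / n := by
  have hn : (n : ℝ) ≠ 0 := Nat.cast_ne_zero.2 (NeZero.ne n)
  unfold uniformVar
  rw [variance_eq_sub (MemLp.of_discrete), integral_uniformOn_univ]
  simp only [Pi.pow_apply]
  rw [integral_uniformOn_univ]
  unfold sumSqDev
  field_simp

lemma sumSqDev_le (x : Fin n → ℝ) (c : ℝ) : sumSqDev x ≤ ∑ i, (x i - c) ^ 2 := by
  have hn : (0 : ℝ) < n := Nat.cast_pos.2 (NeZero.pos n)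
  have h : ∑ i, (x i - c) ^ 2 = sumSqDev x + (∑ i, x i - n * c) ^ 2 / n := by
    simp only [sub_sq, Finset.sum_add_distrib, Finset.sum_sub_distrib, ← Finset.sum_mul,
      ← Finset.mul_sum, Finset.sum_const, Finset.card_univ, Fintype.card_fin, nsmul_eq_mul,
      sumSqDev]
    field_simp
    ring
  rw [h]
  have : 0 ≤ (∑ i, x i - n * c) ^ 2 / n := by positivity
  linarith

/-- Any centre `c` bounds the variance from above, and Cauchy–Schwarz does the rest. With a
deterministic `c`, expectations can be taken vertex by vertex, without any joint law across
vertices. -/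
lemma uniformVar_sq_le (x : Fin n → ℝ) (c : ℝ) :
    uniformVar x ^ 2 ≤ (n : ℝ)⁻¹ * ∑ i, (x i - c) ^ 4 := by
  have hn : (0 : ℝ) < n := Nat.cast_pos.2 (NeZero.pos n)
  have h1 := sq_sum_le_card_mul_sum_sq (s := Finset.univ) (f := fun i => (x i - c) ^ 2)
  rw [Finset.card_univ, Fintype.card_fin] at h1
  rw [uniformVar_eq, div_pow, div_le_iff₀ (by positivity)]
  calc sumSqDev x ^ 2 ≤ (∑ i, (x i - c) ^ 2) ^ 2 :=
        pow_le_pow_left₀ (sumSqDev_nonneg x) (sumSqDev_le x c) 2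
    _ ≤ n * ∑ i, ((x i - c) ^ 2) ^ 2 := h1
    _ = (n : ℝ)⁻¹ * (∑ i, (x i - c) ^ 4) * n ^ 2 := by
        simp_rw [← pow_mul]
        field_simp

end UniformVar

lemma logBarrierSum_eq_logSumExpNeg {n d : ℕ} {G : SimpleGraph (Fin n)} [DecidableRel G.Adj]
    (b : Fin n → Fin n → ℝ) {i : Fin n} (e : Fin d ≃ G.neighborSet i) :
    logBarrierSum G b i = logSumExpNeg fun k => b i (e k) := by
  unfold logBarrierSum logSumExpNeg
  congr 1
  rw [Equiv.sum_comp e fun j : G.neighborSet i => Real.exp (-b i j)]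
  exact Finset.sum_subtype _ (fun j => by simp) fun j => Real.exp (-b i j)

/-! ### Moment bounds for the landscape. -/

section Moments

variable {Ω : Type*} [MeasurableSpace Ω] {P : Measure Ω} {n : ℕ}
  {G : SimpleGraph (Fin n)} {d : ℕ} {σW σB : ℝ}
  {W : Fin n → Ω → ℝ} {B : Fin n → Fin n → Ω → ℝ}

lemma aemeasurable_uniformVar [NeZero n] {X : Fin n → Ω → ℝ} (hX : ∀ i, AEMeasurable (X i) P) :
    AEMeasurable (fun ω => uniformVar fun i => X i ω) P := by
  simp_rw [uniformVar_eq]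
  exact (measurable_sumSqDev.comp_aemeasurable (aemeasurable_pi_lambda _ hX)).div_const _

lemma aemeasurable_logBarrierSum [DecidableRel G.Adj] (hD : IsDisordered P G σW σB W B)
    (i : Fin n) :
    AEMeasurable (fun ω => logBarrierSum G (fun i j => B i j ω) i) P := by
  unfold logBarrierSum
  refine Real.measurable_log.comp_aemeasurable (Finset.aemeasurable_fun_sum _ fun j hj => ?_)
  have := (hD.law_barriers i j ((G.mem_neighborFinset i j).1 hj)).aemeasurable
  fun_prop

variable [IsProbabilityMeasure P] [NeZero n]

lemma exists_lintegral_logBarrierSum_sub_pow_four_le [DecidableRel G.Adj]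
    (hG : G.IsRegularOfDegree d)
    (hD : IsDisordered P G σW σB W B) (hS : IsSeparable P G W B) :
    ∃ c : ℝ, ∀ i, ∫⁻ ω, ENNReal.ofReal ((logBarrierSum G (fun i j => B i j ω) i - c) ^ 4) ∂P ≤
      ENNReal.ofReal (10 * (σB ^ 2) ^ 2) := by
  -- Without edges every `A i` is `log 0 = 0`.
  rcases Nat.eq_zero_or_pos d with rfl | hd
  · refine ⟨0, fun i => ?_⟩
    have hN : G.neighborFinset i = ∅ := by
      rw [← Finset.card_eq_zero, G.card_neighborFinset_eq_degree, hG i]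
    simp [logBarrierSum, hN]
  · obtain ⟨μ, hμG, hmarg, hlaw⟩ := exists_law_barriers hG hd hD hS
    have : Nonempty (Fin d) := ⟨⟨0, hd⟩⟩
    have hmean : μ[id] = 0 := by
      ext k
      have hk := (ContinuousLinearMap.proj (R := ℝ) (φ := fun _ : Fin d => ℝ) k).integral_comp_comm
        (IsGaussian.integrable_id (μ := μ))
      refine hk.symm.trans ?_
      have h := integral_map (μ := μ) (φ := fun x : Fin d → ℝ => x k) (f := fun x : ℝ => x)
        (measurable_pi_apply k).aemeasurable (by fun_prop)
      rw [hmarg k, integral_id_gaussianReal] at h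
      exact h.symm
    have hfour : ∀ k, ∫⁻ x, ENNReal.ofReal (x k ^ 4) ∂μ ≤ ENNReal.ofReal (3 * (σB ^ 2) ^ 2) := by
      intro k
      have h := lintegral_map (μ := μ) (g := fun x : Fin d → ℝ => x k)
        (f := fun x : ℝ => ENNReal.ofReal (x ^ 4)) (by fun_prop) (by fun_prop)
      rw [hmarg k, lintegral_pow_four_gaussianReal, Real.coe_toNNReal _ (sq_nonneg _)] at h
      exact h.symm.le
    refine ⟨μ[logSumExpNeg], fun i => ?_⟩
    obtain ⟨e, he⟩ := hlaw i
    refine le_trans (le_of_eq ?_) (lintegral_logSumExpNeg_sub_mean_pow_four_le μ hmean hfour)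
    have hm := measurable_logSumExpNeg (ι := Fin d)
    have h := lintegral_map' (μ := P)
      (f := fun x : Fin d → ℝ => ENNReal.ofReal ((logSumExpNeg x - μ[logSumExpNeg]) ^ 4))
      (g := fun ω k => B i (e k) ω) (by fun_prop) he.aemeasurable
    rw [he.map_eq] at h
    rw [h]
    refine lintegral_congr fun ω => ?_
    rw [logBarrierSum_eq_logSumExpNeg _ e]

lemma lintegral_uniformVar_logBarrierSum_sq_le [DecidableRel G.Adj]
    (hG : G.IsRegularOfDegree d)
    (hD : IsDisordered P G σW σB W B) (hS : IsSeparable P G W B) :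
    ∫⁻ ω, ENNReal.ofReal (uniformVar (logBarrierSum G fun i j => B i j ω) ^ 2) ∂P ≤
      ENNReal.ofReal (10 * (σB ^ 2) ^ 2) := by
  obtain ⟨c, hc⟩ := exists_lintegral_logBarrierSum_sub_pow_four_le hG hD hS
  have hm := aemeasurable_logBarrierSum hD
  have hn : (0 : ℝ) < n := Nat.cast_pos.2 (NeZero.pos n)
  have hcard : (n : ENNReal) = ENNReal.ofReal n := (ENNReal.ofReal_natCast n).symm
  calc ∫⁻ ω, ENNReal.ofReal (uniformVar (logBarrierSum G fun i j => B i j ω) ^ 2) ∂P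
      ≤ ∫⁻ ω, ENNReal.ofReal (n : ℝ)⁻¹ *
          ∑ i, ENNReal.ofReal ((logBarrierSum G (fun i j => B i j ω) i - c) ^ 4) ∂P := by
        refine lintegral_mono fun ω => ?_
        rw [← ENNReal.ofReal_sum_of_nonneg fun i _ => Even.pow_nonneg (by decide) _,
          ← ENNReal.ofReal_mul (by positivity)]
        exact ENNReal.ofReal_le_ofReal (uniformVar_sq_le _ c)
    _ = ENNReal.ofReal (n : ℝ)⁻¹ *
          ∑ i, ∫⁻ ω, ENNReal.ofReal ((logBarrierSum G (fun i j => B i j ω) i - c) ^ 4) ∂P := by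
        rw [lintegral_const_mul' _ _ ENNReal.ofReal_ne_top, lintegral_finsetSum' _ fun i _ => ?_]
        have := hm i
        fun_prop
    _ ≤ ENNReal.ofReal (n : ℝ)⁻¹ * ∑ _i : Fin n, ENNReal.ofReal (10 * (σB ^ 2) ^ 2) := by
        gcongr with i
        exact hc i
    _ = ENNReal.ofReal (10 * (σB ^ 2) ^ 2) := by
        rw [Finset.sum_const, Finset.card_univ, Fintype.card_fin, nsmul_eq_mul, ← mul_assoc, hcard,
          ← ENNReal.ofReal_mul (by positivity), inv_mul_cancel₀ hn.ne', ENNReal.ofReal_one, one_mul]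

lemma lintegral_inv_uniformVar_sq_le (hn : 6 ≤ n) (hσW : 0 < σW)
    (hD : IsDisordered P G σW σB W B) :
    ∫⁻ ω, ENNReal.ofReal ((uniformVar fun i => W i ω)⁻¹ ^ 2) ∂P ≤
      ENNReal.ofReal (n ^ 2 / ((n - 3) * (n - 5)) / (σW ^ 2) ^ 2) := by
  have hv : (σW ^ 2).toNNReal ≠ 0 := by
    rw [ne_eq, Real.toNNReal_eq_zero, not_le]; positivity
  have hWm : ∀ i, AEMeasurable (W i) P := fun i => (hD.law_wells i).aemeasurable
  have hmap : P.map (fun ω i => W i ω) =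
      Measure.pi fun _ : Fin n => gaussianReal 0 (σW ^ 2).toNNReal := by
    rw [(iIndepFun_iff_map_fun_eq_pi_map hWm).1 hD.indep_wells]
    simp_rw [fun i => (hD.law_wells i).map_eq]
  have h := lintegral_inv_sumSqDev_sq_le hn hv
  have hm := measurable_sumSqDev (n := n)
  rw [← hmap, lintegral_map' (by fun_prop) (aemeasurable_pi_lambda _ hWm),
    Real.coe_toNNReal _ (sq_nonneg _)] at h
  have hpt : ∀ ω, ENNReal.ofReal ((uniformVar fun i => W i ω)⁻¹ ^ 2) =
      ENNReal.ofReal ((n : ℝ) ^ 2) * ENNReal.ofReal ((sumSqDev fun i => W i ω)⁻¹ ^ 2) := by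
    intro ω
    rw [← ENNReal.ofReal_mul (by positivity), uniformVar_eq, inv_div, div_pow, inv_pow,
      div_eq_mul_inv]
  simp_rw [hpt]
  rw [lintegral_const_mul' _ _ ENNReal.ofReal_ne_top]
  refine (mul_le_mul_right h _).trans_eq ?_
  rw [← ENNReal.ofReal_mul (by positivity)]
  congr 1
  rw [div_div, mul_one_div, mul_comm ((σW ^ 2) ^ 2)]

end Moments

/-! ### Constants and conclusion. -/

lemma sq_div_sub_mul_sub_le {n : ℕ} (hn : 6 ≤ n) :
    5 / 4 + 2 * ((n : ℝ) ^ 2 / ((n - 3) * (n - 5))) ≤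
      4 * (1 + 50 * (n : ℝ) ^ (-(1 / 2) : ℝ)) := by
  have hn6 : (6 : ℝ) ≤ n := by exact_mod_cast hn
  have h1 : (n : ℝ)⁻¹ ≤ (n : ℝ) ^ (-(1 / 2) : ℝ) := by
    rw [← Real.rpow_neg_one]
    exact Real.rpow_le_rpow_of_exponent_le (by linarith) (by norm_num)
  -- Since `5 / 4 + 2 < 4`, only the `1 / n` correction matters, and `2 * 100 = 4 * 50` absorbs it.
  have h2 : (n : ℝ) ^ 2 / ((n - 3) * (n - 5)) ≤ 1 + 100 * (n : ℝ)⁻¹ := by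
    rw [div_le_iff₀ (mul_pos (by linarith) (by linarith))]
    have : (1 + 100 * (n : ℝ)⁻¹) * ((n - 3) * (n - 5)) - (n : ℝ) ^ 2 =
        (92 * (n : ℝ) ^ 2 - 785 * n + 1500) / n := by
      field_simp
      ring
    have h3 : 0 ≤ (92 * (n : ℝ) ^ 2 - 785 * n + 1500) / n :=
      div_nonneg (by nlinarith) (by linarith)
    linarith
  linarith

lemma ratio_sq {n : ℕ} (G : SimpleGraph (Fin n)) [DecidableRel G.Adj] (w : Fin n → ℝ)
    (b : Fin n → Fin n → ℝ) :
    ratio G w b ^ 2 = uniformVar (logBarrierSum G b) / uniformVar w :=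
  Real.sq_sqrt (div_nonneg (variance_nonneg _ _) (variance_nonneg _ _))

lemma mul_le_half_weighted_add_sq {a : ℝ} (ha : 0 < a) (x y : ℝ) :
    x * y ≤ a / 2 * x ^ 2 + 1 / (2 * a) * y ^ 2 := by
  have h : a / 2 * x ^ 2 + 1 / (2 * a) * y ^ 2 - x * y = (a * x - y) ^ 2 / (2 * a) := by
    field_simp
    ring
  have : 0 ≤ (a * x - y) ^ 2 / (2 * a) := by positivity
  linarith

end Landscape

theorem proposition4p1 :
    ∃ C : ℝ, ∀ (n : ℕ), 6 ≤ n →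
      ∀ (G : SimpleGraph (Fin n)) [DecidableRel G.Adj] (d : ℕ), G.IsRegularOfDegree d →
      ∀ (σW σB : ℝ), 0 < σW → 0 < σB →
      ∀ (Ω : Type*) [MeasurableSpace Ω] (P : Measure Ω) [IsProbabilityMeasure P]
        (W : Fin n → Ω → ℝ) (B : Fin n → Fin n → Ω → ℝ),
      Landscape.IsDisordered P G σW σB W B → Landscape.IsSeparable P G W B →
      Integrable (fun ω => Landscape.ratio G (fun i => W i ω) (fun i j => B i j ω) ^ 2) P ∧
      ∫ ω, Landscape.ratio G (fun i => W i ω) (fun i j => B i j ω) ^ 2 ∂P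
        ≤ 4 * (1 + C * (n : ℝ) ^ (-(1 / 2) : ℝ)) * (σB / σW) ^ 2 := by
  refine ⟨50, fun n hn G _ d hG σW σB hσW hσB Ω _ P _ W B hD hS => ?_⟩
  have : NeZero n := ⟨by omega⟩
  have hn6 : (6 : ℝ) ≤ n := by exact_mod_cast hn
  have hκ : 0 ≤ (n : ℝ) ^ 2 / ((n - 3) * (n - 5)) :=
    div_nonneg (by positivity) (mul_nonneg (by linarith) (by linarith))
  have hA := Landscape.lintegral_uniformVar_logBarrierSum_sq_le hG hD hS
  have hW := Landscape.lintegral_inv_uniformVar_sq_le hn hσW hD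
  have hAm : AEMeasurable
      (fun ω => Landscape.uniformVar (Landscape.logBarrierSum G fun i j => B i j ω)) P :=
    Landscape.aemeasurable_uniformVar (Landscape.aemeasurable_logBarrierSum hD)
  have hWm : AEMeasurable (fun ω => Landscape.uniformVar fun i => W i ω) P :=
    Landscape.aemeasurable_uniformVar fun i => (hD.law_wells i).aemeasurable
  have hm : AEMeasurable
      (fun ω => Landscape.ratio G (fun i => W i ω) (fun i j => B i j ω) ^ 2) P := by
    simp_rw [Landscape.ratio_sq]
    exact hAm.div hWm
  -- The best weight would have `√10` (for large `n`) in place of 4; with 4 the two terms are `5 /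
  -- 4` and about 2, still below 4 in total.
  set a : ℝ := 1 / (4 * σB ^ 2 * σW ^ 2) with ha
  have ha0 : 0 < a := by positivity
  have hbound : ∫⁻ ω, ENNReal.ofReal
        (Landscape.ratio G (fun i => W i ω) (fun i j => B i j ω) ^ 2) ∂P ≤
      ENNReal.ofReal (4 * (1 + 50 * (n : ℝ) ^ (-(1 / 2) : ℝ)) * (σB / σW) ^ 2) := by
    calc ∫⁻ ω, ENNReal.ofReal (Landscape.ratio G (fun i => W i ω) (fun i j => B i j ω) ^ 2) ∂P
        ≤ ∫⁻ ω, (ENNReal.ofReal (a / 2) * ENNReal.ofReal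
              (Landscape.uniformVar (Landscape.logBarrierSum G fun i j => B i j ω) ^ 2) +
            ENNReal.ofReal (1 / (2 * a)) *
              ENNReal.ofReal ((Landscape.uniformVar fun i => W i ω)⁻¹ ^ 2)) ∂P := by
          refine lintegral_mono fun ω => ?_
          rw [← ENNReal.ofReal_mul (by positivity), ← ENNReal.ofReal_mul (by positivity),
            ← ENNReal.ofReal_add (by positivity) (by positivity), Landscape.ratio_sq,
            div_eq_mul_inv]
          exact ENNReal.ofReal_le_ofReal (Landscape.mul_le_half_weighted_add_sq ha0 _ _)
      _ ≤ ENNReal.ofReal (a / 2) * ENNReal.ofReal (10 * (σB ^ 2) ^ 2) +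
            ENNReal.ofReal (1 / (2 * a)) *
              ENNReal.ofReal ((n : ℝ) ^ 2 / ((n - 3) * (n - 5)) / (σW ^ 2) ^ 2) := by
          rw [lintegral_add_left' (by fun_prop), lintegral_const_mul' _ _ ENNReal.ofReal_ne_top,
            lintegral_const_mul' _ _ ENNReal.ofReal_ne_top]
          gcongr
      _ = ENNReal.ofReal
            ((5 / 4 + 2 * ((n : ℝ) ^ 2 / ((n - 3) * (n - 5)))) * (σB / σW) ^ 2) := by
          rw [← ENNReal.ofReal_mul (by positivity), ← ENNReal.ofReal_mul (by positivity),
            ← ENNReal.ofReal_add (by positivity) (by positivity)]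
          congr 1
          generalize (n : ℝ) ^ 2 / ((n - 3) * (n - 5)) = κ
          rw [ha]
          field_simp
          ring
      _ ≤ _ := by
          gcongr
          exact Landscape.sq_div_sub_mul_sub_le hn
  have hnn : 0 ≤ᵐ[P] fun ω => Landscape.ratio G (fun i => W i ω) (fun i j => B i j ω) ^ 2 :=
    Filter.Eventually.of_forall fun ω => sq_nonneg _
  refine ⟨⟨hm.aestronglyMeasurable, ?_⟩, ?_⟩
  · rw [hasFiniteIntegral_iff_ofReal hnn]
    exact hbound.trans_lt ENNReal.ofReal_lt_top
  · rw [integral_eq_lintegral_of_nonneg_ae hnn hm.aestronglyMeasurable]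
    exact ENNReal.toReal_le_of_le_ofReal (by positivity) hbound
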